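/- Let $\mathrm{Nil}$ be the group of matrices $\begin{pmatrix}1&x&z\\0&1&y\\0&0&1\end{pmatrix}$, $x,y,z\in\mathbb R$, with the left invariant metric $dx^2+dy^2+(dz-x\,dy)^2$, whose Levi-Civita connection is $\nabla$, and let $e_1,e_2,e_3$ be the left invariant orthonormal frame equal to $\partial_x,\partial_y,\partial_z$ at the unit; it orients $\mathrm{Nil}$. Let $f:M\to\mathrm{Nil}$ be a smooth immersion of an oriented surface, $N$ its unit normal field compatible with the orientations (so that $\langle N, f_x\times f_y\rangle>0$ in positively oriented coordinates $x,y$ on $M$), and suppose that the mean curvature with respect to $N$ (half of the trace of the second fundamental form) is a constant $H\in\mathbb R$. For a positively oriented conformal parameter $w=x+iy$ on an open subset of $M$ (i.e. the induced metric is $e^{2\alpha}\,dw\,d\bar w$) write $\partial=\frac12(\partial_x-i\partial_y)$, $f^{-1}\partial f=\sum_k Z_k e_k$, and let $$A=\langle\nabla_{\partial f}\,\partial f,\,N\rangle$$ (with $\nabla$ and the metric extended complex bilinearly) be the coefficient of the Hopf differential $A\,dw^2$. Then the quadratic differential $$\widetilde A\,dw^2=\left(A+\frac{Z_3^2}{2H+i}\right)dw^2$$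 is well defined and holomorphic: in every such parameter the function $\widetilde A$ is holomorphic; a change from such a parameter $w$ to another one, $v$, is a holomorphic map, and $\widetilde A^{(w)}=\widetilde A^{(v)}\,(dv/dw)^2$. For every generating spinor $\psi=(\psi_1,\psi_2)$ of the surface, i.e. functions with $Z_1=\frac i2(\bar\psi_2^2+\psi_1^2)$, $Z_2=\frac12(\bar\psi_2^2-\psi_1^2)$, $Z_3=\psi_1\bar\psi_2$, the coefficient is $\widetilde A=A+\frac{(\psi_1\bar\psi_2)^2}{2H+i}$. -/

import Mathlib

open scoped Manifold ContDiff Matrix ComplexConjugate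

/-- The group Nil: `⟨x, y, z⟩` stands for the matrix `!![1, x, z; 0, 1, y; 0, 0, 1]`. -/
@[ext]
structure NilGroup where
  x : ℝ
  y : ℝ
  z : ℝ

namespace NilGroup

def toMatrix (g : NilGroup) : Matrix (Fin 3) (Fin 3) ℝ :=
  !![1, g.x, g.z; 0, 1, g.y; 0, 0, 1]

instance : Mul NilGroup := ⟨fun g h => ⟨g.x + h.x, g.y + h.y, g.z + h.z + g.x * h.y⟩⟩
instance : One NilGroup := ⟨⟨0, 0, 0⟩⟩
instance : Inv NilGroup := ⟨fun g => ⟨-g.x, -g.y, -g.z + g.x * g.y⟩⟩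

@[simp] theorem mul_x (g h : NilGroup) : (g * h).x = g.x + h.x := rfl
@[simp] theorem mul_y (g h : NilGroup) : (g * h).y = g.y + h.y := rfl
@[simp] theorem mul_z (g h : NilGroup) : (g * h).z = g.z + h.z + g.x * h.y := rfl
@[simp] theorem one_x : (1 : NilGroup).x = 0 := rfl
@[simp] theorem one_y : (1 : NilGroup).y = 0 := rfl
@[simp] theorem one_z : (1 : NilGroup).z = 0 := rfl
@[simp] theorem inv_x (g : NilGroup) : g⁻¹.x = -g.x := rfl
@[simp] theorem inv_y (g : NilGroup) : g⁻¹.y = -g.y := rfl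
@[simp] theorem inv_z (g : NilGroup) : g⁻¹.z = -g.z + g.x * g.y := rfl

instance : Group NilGroup where
  mul_assoc a b c := by ext <;> simp <;> ring
  one_mul a := by ext <;> simp
  mul_one a := by ext <;> simp
  inv_mul_cancel a := by ext <;> simp

/-- The group law is multiplication of matrices. -/
theorem toMatrix_mul (g h : NilGroup) : (g * h).toMatrix = g.toMatrix * h.toMatrix := by
  ext i j
  fin_cases i <;> fin_cases j <;>
    simp [toMatrix, Matrix.mul_apply, Fin.sum_univ_three] <;> ring

/-- The global coordinates `(x, y, z)`, which give Nil its smooth structure. -/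
def coords (g : NilGroup) : Fin 3 → ℝ := ![g.x, g.y, g.z]

/-- The basis `e₁, e₂, e₃` (indexed by `0, 1, 2`) of the Lie algebra of Nil. -/
def e : Fin 3 → Matrix (Fin 3) (Fin 3) ℝ :=
  ![!![0, 1, 0; 0, 0, 0; 0, 0, 0], !![0, 0, 0; 0, 0, 1; 0, 0, 0], !![0, 0, 1; 0, 0, 0; 0, 0, 0]]

/-- Components in the basis `e₁, e₂, e₃` of an element of the Lie algebra. -/
def lieCoord (X : Matrix (Fin 3) (Fin 3) ℝ) : Fin 3 → ℝ := ![X 0 1, X 1 2, X 0 2]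

/-- `g⁻¹ · w` in the basis `e₁, e₂, e₃`, where `w = (dx, dy, dz)` is a tangent vector at `g`,
i.e. the matrix `∑ wₖ eₖ`. -/
def leftTrans (g : NilGroup) (w : Fin 3 → ℝ) : Fin 3 → ℝ :=
  lieCoord (g⁻¹.toMatrix * ∑ k, w k • e k)

/-- The left-invariant coframe is `dx, dy, dz - x dy`; the metric `dx² + dy² + (dz - x dy)²` is
therefore the standard dot product of left translated vectors. -/
theorem leftTrans_eq (g : NilGroup) (w : Fin 3 → ℝ) :
    leftTrans g w = ![w 0, w 1, w 2 - g.x * w 1] := by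
  ext i
  fin_cases i <;>
    simp [leftTrans, lieCoord, toMatrix, e, Fin.sum_univ_three, Matrix.mul_apply] <;> ring

/-- `αᵢⱼₖ = ⟨[eᵢ, eⱼ], eₖ⟩`. -/
noncomputable def structConst (i j k : Fin 3) : ℝ := lieCoord ⁅e i, e j⁆ k

/-- `⟨∇_{eₖ} eⱼ, eᵢ⟩` for the Levi-Civita connection of the left-invariant metric in which
`e₁, e₂, e₃` are orthonormal (Koszul formula for a left-invariant orthonormal frame). -/
noncomputable def leviCivita (k j i : Fin 3) : ℝ :=
  (1 / 2) * (structConst k j i + structConst i k j + structConst i j k)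

/-- The connection is torsion free. -/
theorem leviCivita_torsion (k j i : Fin 3) :
    leviCivita k j i - leviCivita j k i = structConst k j i := by
  fin_cases i <;> fin_cases j <;> fin_cases k <;>
    simp [leviCivita, structConst, lieCoord, e, Ring.lie_def] <;> norm_num

/-- The connection is compatible with the metric. -/
theorem leviCivita_metric (k j i : Fin 3) : leviCivita k j i + leviCivita k i j = 0 := by
  fin_cases i <;> fin_cases j <;> fin_cases k <;>
    simp [leviCivita, structConst, lieCoord, e, Ring.lie_def]

/-- The bilinear extension `∑ aₖ bⱼ ∇_{eₖ} eⱼ`, over `ℝ` or complexified. -/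
noncomputable def connection {K : Type*} [RCLike K] (a b : Fin 3 → K) : Fin 3 → K :=
  fun i => ∑ k, ∑ j, a k * b j * ((leviCivita k j i : ℝ) : K)

end NilGroup

/-! ### A map `F` from a domain of the parameter plane `ℂ` to Nil

All vectors along `F` are left translated and written in the basis `e₁, e₂, e₃`.
In the parameter `u = x + i y`, the vectors `1` and `Complex.I` are the directions of `x` and `y`. -/

/-- `F⁻¹ dF(v)` at `u`. -/
noncomputable def leftVelocity (F : ℂ → NilGroup) (u v : ℂ) : Fin 3 → ℝ :=
  (F u).leftTrans (fderiv ℝ (fun t => (F t).coords) u v)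

/-- The covariant derivative `∇_{∂ₐF} ∂_bF` at `u`, for constant directions `a`, `b`. -/
noncomputable def covDeriv (F : ℂ → NilGroup) (u a b : ℂ) : Fin 3 → ℝ :=
  fderiv ℝ (fun t => leftVelocity F t b) u a
    + NilGroup.connection (leftVelocity F u a) (leftVelocity F u b)

/-- The coordinate directions of the parameter plane. -/
noncomputable def coordDir : Fin 2 → ℂ := ![1, Complex.I]

noncomputable def firstFundamentalForm (F : ℂ → NilGroup) (u : ℂ) : Matrix (Fin 2) (Fin 2) ℝ :=
  Matrix.of fun i j => leftVelocity F u (coordDir i) ⬝ᵥ leftVelocity F u (coordDir j)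

/-- Second fundamental form with respect to the normal field `N` along `F`. -/
noncomputable def secondFundamentalForm (F : ℂ → NilGroup) (N : ℂ → Fin 3 → ℝ) (u : ℂ) :
    Matrix (Fin 2) (Fin 2) ℝ :=
  Matrix.of fun i j => covDeriv F u (coordDir i) (coordDir j) ⬝ᵥ N u

/-- The mean curvature: half the trace of the second fundamental form with respect to the first. -/
noncomputable def meanCurvature (F : ℂ → NilGroup) (N : ℂ → Fin 3 → ℝ) (u : ℂ) : ℝ :=
  (1 / 2) * ((firstFundamentalForm F u)⁻¹ * secondFundamentalForm F N u).trace

/-- `∂ = (∂/∂x - i ∂/∂y) / 2`. -/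
noncomputable def wirtinger (h : ℂ → ℂ) (u : ℂ) : ℂ :=
  (1 / 2) * (fderiv ℝ h u 1 - Complex.I * fderiv ℝ h u Complex.I)

/-- The components `Z₁, Z₂, Z₃` (indexed by `0, 1, 2`) of `F⁻¹ ∂F`. -/
noncomputable def zComp (F : ℂ → NilGroup) (u : ℂ) : Fin 3 → ℂ := fun k =>
  (1 / 2) * ((leftVelocity F u 1 k : ℂ) - Complex.I * (leftVelocity F u Complex.I k : ℂ))

/-- The coefficient `A = ⟨∇_{∂F} ∂F, N⟩` of the Hopf differential (complex bilinear extension of the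
connection and of the metric). -/
noncomputable def hopfCoeff (F : ℂ → NilGroup) (N : ℂ → Fin 3 → ℝ) (u : ℂ) : ℂ :=
  ((fun k => wirtinger (fun t => zComp F t k) u)
    + NilGroup.connection (zComp F u) (zComp F u)) ⬝ᵥ (fun k => (N u k : ℂ))

/-- `(ψ₁, ψ₂)` is a generating spinor of `F` on `U`. -/
def IsGeneratingSpinor (F : ℂ → NilGroup) (U : Set ℂ) (ψ₁ ψ₂ : ℂ → ℂ) : Prop :=
  ∀ u ∈ U,
    zComp F u 0 = Complex.I / 2 * (conj (ψ₂ u) ^ 2 + ψ₁ u ^ 2) ∧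
    zComp F u 1 = 1 / 2 * (conj (ψ₂ u) ^ 2 - ψ₁ u ^ 2) ∧
    zComp F u 2 = ψ₁ u * conj (ψ₂ u)

/-- The coefficient `A + Z₃² / (2H + i)`. -/
noncomputable def abreschCoeff (F : ℂ → NilGroup) (N : ℂ → Fin 3 → ℝ) (H : ℝ) (u : ℂ) : ℂ :=
  hopfCoeff F N u + zComp F u 2 ^ 2 / (2 * (H : ℂ) + Complex.I)

/-! ### Surfaces in Nil

`M` is a real smooth surface, with charts in the real plane underlying `ℂ`. -/

section Surfaces

variable {M : Type*} [TopologicalSpace M] [ChartedSpace ℂ M]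

/-- `f` is a smooth immersion into Nil. -/
def IsNilImmersion (f : M → NilGroup) : Prop :=
  ContMDiff 𝓘(ℝ, ℂ) 𝓘(ℝ, Fin 3 → ℝ) ∞ (fun p => (f p).coords) ∧
  ∀ p : M, Function.Injective
    (mfderiv 𝓘(ℝ, ℂ) 𝓘(ℝ, Fin 3 → ℝ) (fun q => (f q).coords) p)

/-- `n` is the left translate `f⁻¹ N` of a continuous unit normal field `N` along `f`. As Nil is
oriented by `e₁, e₂, e₃`, such a field is the same as an orientation of `M`. -/
def IsNilUnitNormal (f : M → NilGroup) (n : M → Fin 3 → ℝ) : Prop :=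
  Continuous n ∧ (∀ p, n p ⬝ᵥ n p = 1) ∧
  ∀ (p : M) (v : TangentSpace 𝓘(ℝ, ℂ) p),
    n p ⬝ᵥ (f p).leftTrans (mfderiv 𝓘(ℝ, ℂ) 𝓘(ℝ, Fin 3 → ℝ) (fun q => (f q).coords) p v) = 0

/-- The mean curvature with respect to `n`, computed in any smooth local coordinates, is
identically `H`. -/
def HasConstMeanCurvature (f : M → NilGroup) (n : M → Fin 3 → ℝ) (H : ℝ) : Prop :=
  ∀ z ∈ IsManifold.maximalAtlas 𝓘(ℝ, ℂ) ∞ M, ∀ u ∈ z.target,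
    meanCurvature (f ∘ z.symm) (n ∘ z.symm) u = H

/-- `z` is a conformal parameter on an open subset of `M`: a smooth chart in which the induced metric
is `exp (2α) dz dz̄`, and which is positively oriented for the orientation defined by `n`. -/
def IsConformalParameter (f : M → NilGroup) (n : M → Fin 3 → ℝ)
    (z : OpenPartialHomeomorph M ℂ) : Prop :=
  z ∈ IsManifold.maximalAtlas 𝓘(ℝ, ℂ) ∞ M ∧
  ∀ u ∈ z.target,
    (∃ α : ℝ, firstFundamentalForm (f ∘ z.symm) u = Real.exp (2 * α) • 1) ∧
    0 < n (z.symm u) ⬝ᵥ crossProduct (leftVelocity (f ∘ z.symm) u 1)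
      (leftVelocity (f ∘ z.symm) u Complex.I)

end Surfaces

/-!
Let `Z`, `Z̄` and `N` be the left translates of `∂F`, `∂̄F` and of the normal in a conformal
parameter with metric `E |du|²`. Constant mean curvature says that `∇_∂̄ Z = (H E / 2) N`, hence
`∇_∂̄ N = a Z - H Z̄` for some function `a`, and exchanging `∇_∂̄` and `∇_∂` on `Z` leaves only a
curvature term: `∂̄A = ⟨R(Z̄, Z) Z, N⟩ = -(E / 2) N₃ Z₃`. On the other hand the third component of
`∇_∂̄ Z = (H E / 2) N` reads `∂̄Z₃ = (E / 4) (2 H + i) N₃`, so that `∂̄A` is cancelled by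
`∂̄(Z₃² / (2 H + i))`.

For a change of parameter `g`, the ratio of the two conformal factors is `|∂g|² + |∂̄g|²` by
comparison of the products `⟨Z, Z̄⟩` and `|∂g|² - |∂̄g|²` by comparison of the oriented products
`Z × Z̄`, so `∂̄g = 0`.
-/

section AbreschRosenberg

open Complex

/-! ### Wirtinger derivatives -/

section Wirtinger

variable {E F G : Type*} [NormedAddCommGroup E] [NormedSpace ℂ E] [NormedAddCommGroup F]
  [NormedSpace ℂ F] [NormedAddCommGroup G] [NormedSpace ℂ G] {c d u : ℂ}

/-- The operator `(∂/∂x + c ∂/∂y) / 2`; it is `∂` for `c = -i` and `∂̄` for `c = i`. -/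
noncomputable def wirtingerDeriv (c : ℂ) (h : ℂ → E) (u : ℂ) : E :=
  (1 / 2 : ℂ) • (fderiv ℝ h u 1 + c • fderiv ℝ h u I)

theorem wirtinger_eq_wirtingerDeriv (h : ℂ → ℂ) : wirtinger h = wirtingerDeriv (-I) h := by
  funext u
  simp only [wirtinger, wirtingerDeriv, smul_eq_mul, neg_mul, sub_eq_add_neg]

theorem wirtingerDeriv_congr {h k : ℂ → E} (hhk : h =ᶠ[nhds u] k) :
    wirtingerDeriv c h u = wirtingerDeriv c k u := by
  simp only [wirtingerDeriv, hhk.fderiv_eq]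

theorem wirtingerDeriv_eq_zero_of_eqOn_const {h : ℂ → E} {a : E} {U : Set ℂ} (hU : IsOpen U)
    (hu : u ∈ U) (ha : ∀ t ∈ U, h t = a) : wirtingerDeriv c h u = 0 := by
  have hha : h =ᶠ[nhds u] fun _ => a := Filter.eventually_of_mem (hU.mem_nhds hu) ha
  simp [wirtingerDeriv, hha.fderiv_eq]

theorem wirtingerDeriv_add {h k : ℂ → E} (hh : DifferentiableAt ℝ h u)
    (hk : DifferentiableAt ℝ k u) :
    wirtingerDeriv c (fun t => h t + k t) u = wirtingerDeriv c h u + wirtingerDeriv c k u := by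
  simp only [wirtingerDeriv, fderiv_fun_add hh hk, add_apply]
  module

theorem wirtingerDeriv_clm_apply (L : E →L[ℂ] F) {h : ℂ → E} (hh : DifferentiableAt ℝ h u) :
    wirtingerDeriv c (fun t => L (h t)) u = L (wirtingerDeriv c h u) := by
  have hL : HasFDerivAt (fun t => L (h t)) _ u :=
    (L.restrictScalars ℝ).hasFDerivAt.comp u hh.hasFDerivAt
  simp [wirtingerDeriv, hL.fderiv]

theorem wirtingerDeriv_const_smul (a : ℂ) {h : ℂ → E} (hh : DifferentiableAt ℝ h u) :
    wirtingerDeriv c (fun t => a • h t) u = a • wirtingerDeriv c h u :=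
  wirtingerDeriv_clm_apply (a • .id ℂ E) hh

theorem differentiableAt_bilin (B : E →L[ℂ] F →L[ℂ] G) {v : ℂ → E} {w : ℂ → F}
    (hv : DifferentiableAt ℝ v u) (hw : DifferentiableAt ℝ w u) :
    DifferentiableAt ℝ (fun t => B (v t) (w t)) u :=
  ((B.bilinearRestrictScalars ℝ).hasFDerivAt_of_bilinear hv.hasFDerivAt
    hw.hasFDerivAt).differentiableAt

theorem wirtingerDeriv_bilin (B : E →L[ℂ] F →L[ℂ] G) {v : ℂ → E} {w : ℂ → F}
    (hv : DifferentiableAt ℝ v u) (hw : DifferentiableAt ℝ w u) :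
    wirtingerDeriv c (fun t => B (v t) (w t)) u =
      B (wirtingerDeriv c v u) (w u) + B (v u) (wirtingerDeriv c w u) := by
  have hB : HasFDerivAt (fun t => B (v t) (w t)) _ u :=
    (B.bilinearRestrictScalars ℝ).hasFDerivAt_of_bilinear hv.hasFDerivAt hw.hasFDerivAt
  simp only [wirtingerDeriv, hB.fderiv, add_apply, ContinuousLinearMap.comp_apply,
    ContinuousLinearMap.precompR_apply, ContinuousLinearMap.precompL_apply,
    ContinuousLinearMap.compL_apply, ContinuousLinearMap.bilinearRestrictScalars_apply_apply,
    map_add, map_smul, smul_apply]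
  module

theorem wirtingerDeriv_smul {h : ℂ → ℂ} {v : ℂ → E} (hh : DifferentiableAt ℝ h u)
    (hv : DifferentiableAt ℝ v u) :
    wirtingerDeriv c (fun t => h t • v t) u =
      wirtingerDeriv c h u • v u + h u • wirtingerDeriv c v u :=
  wirtingerDeriv_bilin (ContinuousLinearMap.lsmul ℂ ℂ) hh hv

theorem fderiv_eq_wirtingerDeriv (h : ℂ → E) (u a : ℂ) :
    fderiv ℝ h u a = a • wirtingerDeriv (-I) h u + conj a • wirtingerDeriv I h u := by
  have ha : a = a.re • (1 : ℂ) + a.im • I := by simp [re_add_im]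
  have hre := add_conj a
  have him := sub_conj a
  push_cast at hre him
  conv_lhs => rw [ha, map_add, map_smul, map_smul]
  rw [← coe_smul, ← coe_smul]
  simp only [wirtingerDeriv]
  match_scalars
  · linear_combination (-1 / 2) * hre
  · linear_combination I / 2 * him + a.im * I_mul_I

theorem wirtingerDeriv_comp {h : ℂ → E} {g : ℂ → ℂ} (hh : DifferentiableAt ℝ h (g u))
    (hg : DifferentiableAt ℝ g u) :
    wirtingerDeriv c (fun t => h (g t)) u =
      wirtingerDeriv c g u • wirtingerDeriv (-I) h (g u) +
        conj (wirtingerDeriv (conj c) g u) • wirtingerDeriv I h (g u) := by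
  have hhg : HasFDerivAt (fun t => h (g t)) _ u := hh.hasFDerivAt.comp u hg.hasFDerivAt
  simp only [wirtingerDeriv.eq_1 c, wirtingerDeriv.eq_1 (conj c), hhg.fderiv,
    ContinuousLinearMap.comp_apply, fderiv_eq_wirtingerDeriv h (g u), smul_eq_mul, map_mul, map_add,
    conj_conj, map_div₀, map_one, map_ofNat]
  module

theorem differentiableAt_complex_iff_wirtingerDeriv {h : ℂ → E} :
    DifferentiableAt ℂ h u ↔ DifferentiableAt ℝ h u ∧ wirtingerDeriv I h u = 0 := by
  have hI (x y : E) : y = I • x ↔ x + I • y = 0 := by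
    rw [← (smul_right_injective E I_ne_zero).eq_iff, smul_smul, I_mul_I, neg_one_smul,
      eq_neg_iff_add_eq_zero, add_comm]
  simp only [differentiableAt_complex_iff_differentiableAt_real, wirtingerDeriv, hI, smul_eq_zero,
    one_div, inv_eq_zero, OfNat.ofNat_ne_zero, false_or]

theorem wirtingerDeriv_neg_I_eq_deriv {g : ℂ → ℂ} (hg : DifferentiableAt ℂ g u) :
    wirtingerDeriv (-I) g u = deriv g u := by
  obtain ⟨-, hI⟩ := differentiableAt_complex_iff_wirtingerDeriv.1 hg
  have h1 := fderiv_eq_wirtingerDeriv g u 1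
  rw [hI, hg.fderiv_restrictScalars ℝ] at h1
  simpa using h1.symm

section Real

variable {V W : Type*} [NormedAddCommGroup V] [NormedSpace ℝ V] [NormedAddCommGroup W]
  [NormedSpace ℝ W] {g : V → W} {x : V}

theorem contDiffAt_fderiv_apply {m n : ℕ∞ω} (hg : ContDiffAt ℝ n g x) (hmn : m + 1 ≤ n) (v : V) :
    ContDiffAt ℝ m (fun t => fderiv ℝ g t v) x :=
  (hg.fderiv_right hmn).clm_apply contDiffAt_const

theorem fderiv_fderiv_apply_comm (hg : ContDiffAt ℝ 2 g x) (v w : V) :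
    fderiv ℝ (fun t => fderiv ℝ g t v) x w = fderiv ℝ (fun t => fderiv ℝ g t w) x v := by
  have hd : DifferentiableAt ℝ (fderiv ℝ g) x :=
    (hg.fderiv_right (m := 1) (by norm_num)).differentiableAt one_ne_zero
  rw [fderiv_clm_apply hd (differentiableAt_const v),
    fderiv_clm_apply hd (differentiableAt_const w)]
  simpa using hg.isSymmSndFDerivAt (by simp) w v

end Real

theorem contDiffAt_wirtingerDeriv {m n : ℕ∞ω} {h : ℂ → E} (hh : ContDiffAt ℝ n h u)
    (hmn : m + 1 ≤ n) : ContDiffAt ℝ m (wirtingerDeriv c h) u :=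
  contDiffAt_const.smul ((contDiffAt_fderiv_apply hh hmn 1).add
    (contDiffAt_const.smul (contDiffAt_fderiv_apply hh hmn I)))

theorem wirtingerDeriv_comm {h : ℂ → E} (hh : ContDiffAt ℝ 2 h u) :
    wirtingerDeriv c (wirtingerDeriv d h) u = wirtingerDeriv d (wirtingerDeriv c h) u := by
  have hd (v : ℂ) : DifferentiableAt ℝ (fun t => fderiv ℝ h t v) u :=
    (contDiffAt_fderiv_apply hh (m := 1) (by norm_num) v).differentiableAt one_ne_zero
  have hfd (a v : ℂ) : fderiv ℝ (wirtingerDeriv a h) u v =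
      (1 / 2 : ℂ) • (fderiv ℝ (fun t => fderiv ℝ h t 1) u v
        + a • fderiv ℝ (fun t => fderiv ℝ h t I) u v) := by
    have := ((hd 1).hasFDerivAt.add ((hd I).hasFDerivAt.const_smul a)).const_smul (1 / 2 : ℂ)
    exact DFunLike.congr_fun this.fderiv v
  simp only [wirtingerDeriv.eq_1 c (wirtingerDeriv d h), wirtingerDeriv.eq_1 d (wirtingerDeriv c h),
    hfd, fderiv_fderiv_apply_comm hh I 1]
  module

end Wirtinger

/-! ### The left-invariant connection of Nil -/

namespace NilGroup

theorem connection_eq {K : Type*} [RCLike K] (a b : Fin 3 → K) :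
    connection a b = ![(a 1 * b 2 + a 2 * b 1) / 2, -(a 0 * b 2 + a 2 * b 0) / 2,
      (a 0 * b 1 - a 1 * b 0) / 2] := by
  ext i
  fin_cases i <;>
    simp [connection, Fin.sum_univ_three, leviCivita, structConst, lieCoord, e, Ring.lie_def,
      map_ofNat (algebraMap ℝ K)] <;>
    ring

theorem connection_dotProduct_add {K : Type*} [RCLike K] (a b c : Fin 3 → K) :
    connection a b ⬝ᵥ c + b ⬝ᵥ connection a c = 0 := by
  simp only [connection_eq, Matrix.vec3_dotProduct, Matrix.cons_val]
  ring

/-- The complexified bilinear part of left translation: `g⁻¹ · w = w + leftTransCLM g w` in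
coordinates. -/
noncomputable def leftTransCLM : (Fin 3 → ℂ) →L[ℂ] (Fin 3 → ℂ) →L[ℂ] (Fin 3 → ℂ) :=
  (LinearMap.mk₂ ℂ (fun a b : Fin 3 → ℂ => ![0, 0, -(a 0 * b 1)])
    (fun a a' b => by ext i; fin_cases i <;> simp; ring)
    (fun r a b => by ext i; fin_cases i <;> simp; ring)
    (fun a b b' => by ext i; fin_cases i <;> simp; ring)
    (fun r a b => by ext i; fin_cases i <;> simp; ring)).toContinuousBilinearMap

theorem leftTransCLM_apply (a b : Fin 3 → ℂ) : leftTransCLM a b = ![0, 0, -(a 0 * b 1)] := rfl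

theorem connection_sub_connection_swap (a b : Fin 3 → ℂ) :
    connection a b - connection b a = leftTransCLM b a - leftTransCLM a b := by
  ext i
  fin_cases i <;> simp [connection_eq, leftTransCLM_apply] <;> ring

/-- The connection of Nil as a bilinear map. -/
noncomputable def connectionCLM : (Fin 3 → ℂ) →L[ℂ] (Fin 3 → ℂ) →L[ℂ] (Fin 3 → ℂ) :=
  (LinearMap.mk₂ ℂ connection
    (fun a a' b => by ext i; fin_cases i <;> simp [connection_eq] <;> ring)
    (fun r a b => by ext i; fin_cases i <;> simp [connection_eq] <;> ring)
    (fun a b b' => by ext i; fin_cases i <;> simp [connection_eq] <;> ring)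
    (fun r a b => by ext i; fin_cases i <;> simp [connection_eq] <;> ring)).toContinuousBilinearMap

@[simp]
theorem connectionCLM_apply (a b : Fin 3 → ℂ) : connectionCLM a b = connection a b := rfl

/-- The curvature tensor `∇ₐ ∇_b c - ∇_b ∇ₐ c - ∇_{[a, b]} c` of Nil. -/
noncomputable def curvature {K : Type*} [RCLike K] (a b c : Fin 3 → K) : Fin 3 → K :=
  connection a (connection b c) - connection b (connection a c)
    - connection (connection a b - connection b a) c

theorem curvature_dotProduct {K : Type*} [RCLike K] (a b c d : Fin 3 → K) :
    curvature a b c ⬝ᵥ d = (a ⨯₃ b) 2 * (c ⨯₃ d) 2 - 1 / 4 * ((a ⨯₃ b) ⬝ᵥ (c ⨯₃ d)) := by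
  simp only [curvature, connection_eq, cross_apply, Matrix.vec3_dotProduct, Pi.sub_apply,
    Matrix.cons_val]
  ring

end NilGroup

/-! ### Covariant derivatives along a map to Nil -/

section Covariant

open NilGroup

/-- The inclusion of real vectors into complex vectors. -/
noncomputable def complexify : (Fin 3 → ℝ) →L[ℝ] (Fin 3 → ℂ) :=
  ContinuousLinearMap.piMap fun _ => ofRealCLM

@[simp]
theorem complexify_apply (v : Fin 3 → ℝ) (k : Fin 3) : complexify v k = v k := rfl

theorem complexify_dotProduct (v w : Fin 3 → ℝ) :
    complexify v ⬝ᵥ complexify w = ((v ⬝ᵥ w : ℝ) : ℂ) := by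
  simp [dotProduct]

theorem connection_complexify (v w : Fin 3 → ℝ) :
    connection (complexify v) (complexify w) = complexify (connection v w) := by
  ext k
  simp [connection]

theorem crossProduct_complexify (v w : Fin 3 → ℝ) :
    complexify v ⨯₃ complexify w = complexify (v ⨯₃ w) := by
  ext k
  fin_cases k <;> simp [cross_apply]

/-- The dot product as a bilinear map. -/
noncomputable def dotProductCLM : (Fin 3 → ℂ) →L[ℂ] (Fin 3 → ℂ) →L[ℂ] ℂ :=
  (LinearMap.mk₂ ℂ (fun a b : Fin 3 → ℂ => a ⬝ᵥ b) (fun a b v => add_dotProduct a b v)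
    (fun r a b => smul_dotProduct r a b) (fun a b v => dotProduct_add a b v)
    (fun r a b => dotProduct_smul r a b)).toContinuousBilinearMap

@[simp]
theorem dotProductCLM_apply (a b : Fin 3 → ℂ) : dotProductCLM a b = a ⬝ᵥ b := rfl

variable {F : ℂ → NilGroup} {V W : ℂ → Fin 3 → ℂ} {h : ℂ → ℂ} {c d u : ℂ}

/-- The left translate of `∂F` for `c = -i` and of `∂̄F` for `c = i`, compare `wirtingerDeriv`. -/
noncomputable def complexVelocity (F : ℂ → NilGroup) (c u : ℂ) : Fin 3 → ℂ :=
  (1 / 2 : ℂ) • (complexify (leftVelocity F u 1) + c • complexify (leftVelocity F u I))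

/-- The covariant derivative `∇_∂ V` for `c = -i` and `∇_∂̄ V` for `c = i`, where `V` is a left
translated complex vector field along `F`. -/
noncomputable def covWirtinger (F : ℂ → NilGroup) (c : ℂ) (V : ℂ → Fin 3 → ℂ) (u : ℂ) :
    Fin 3 → ℂ :=
  wirtingerDeriv c V u + connection (complexVelocity F c u) (V u)

theorem zComp_eq_complexVelocity (F : ℂ → NilGroup) : zComp F = complexVelocity F (-I) := by
  ext u k
  simp [zComp, complexVelocity, sub_eq_add_neg]

theorem contDiffAt_leftVelocity {m n : ℕ∞ω} (hF : ContDiffAt ℝ n (fun t => (F t).coords) u)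
    (hmn : m + 1 ≤ n) (v : ℂ) : ContDiffAt ℝ m (fun t => leftVelocity F t v) u := by
  have hx : ContDiffAt ℝ m (fun t => (F t).x) u :=
    (contDiffAt_pi.1 (hF.of_le (le_self_add.trans hmn)) 0 :)
  have hD := contDiffAt_pi.1 (contDiffAt_fderiv_apply hF hmn v)
  simp only [leftVelocity, leftTrans_eq]
  refine contDiffAt_pi.2 fun k => ?_
  fin_cases k
  exacts [hD 0, hD 1, (hD 2).sub (hx.mul (hD 1))]

theorem contDiffAt_complexVelocity {m n : ℕ∞ω} (hF : ContDiffAt ℝ n (fun t => (F t).coords) u)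
    (hmn : m + 1 ≤ n) : ContDiffAt ℝ m (complexVelocity F c) u :=
  have hv (v : ℂ) : ContDiffAt ℝ m (fun t => complexify (leftVelocity F t v)) u :=
    complexify.contDiff.contDiffAt.comp u (contDiffAt_leftVelocity hF hmn v)
  ((hv 1).add ((hv I).const_smul c)).const_smul (1 / 2 : ℂ)

theorem differentiableAt_complexVelocity (hF : ContDiffAt ℝ 2 (fun t => (F t).coords) u) :
    DifferentiableAt ℝ (complexVelocity F c) u :=
  (contDiffAt_complexVelocity hF (m := 1) (by norm_num)).differentiableAt one_ne_zero

theorem wirtingerDeriv_complexify {g : ℂ → Fin 3 → ℝ} (hg : DifferentiableAt ℝ g u) :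
    wirtingerDeriv c (fun t => complexify (g t)) u =
      (1 / 2 : ℂ) • (complexify (fderiv ℝ g u 1) + c • complexify (fderiv ℝ g u I)) := by
  have hcg : HasFDerivAt (fun t => complexify (g t)) _ u :=
    complexify.hasFDerivAt.comp u hg.hasFDerivAt
  simp only [wirtingerDeriv, hcg.fderiv, ContinuousLinearMap.comp_apply]

theorem complexVelocity_eq_wirtingerDeriv (hF : DifferentiableAt ℝ (fun t => (F t).coords) u) :
    complexVelocity F c u = wirtingerDeriv c (fun t => complexify (F t).coords) u +
      leftTransCLM (complexify (F u).coords)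
        (wirtingerDeriv c (fun t => complexify (F t).coords) u) := by
  rw [wirtingerDeriv_complexify hF]
  ext k
  fin_cases k <;>
    simp [complexVelocity, leftVelocity, leftTrans_eq, leftTransCLM_apply, coords] <;> ring

theorem wirtingerDeriv_dotProduct (F : ℂ → NilGroup) (hV : DifferentiableAt ℝ V u)
    (hW : DifferentiableAt ℝ W u) :
    wirtingerDeriv c (fun t => V t ⬝ᵥ W t) u =
      covWirtinger F c V u ⬝ᵥ W u + V u ⬝ᵥ covWirtinger F c W u := by
  have hVW := wirtingerDeriv_bilin (c := c) dotProductCLM hV hW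
  simp only [dotProductCLM_apply] at hVW
  rw [hVW, covWirtinger, covWirtinger, add_dotProduct, dotProduct_add]
  linear_combination -connection_dotProduct_add (complexVelocity F c u) (V u) (W u)

theorem covWirtinger_smul (F : ℂ → NilGroup) (hh : DifferentiableAt ℝ h u)
    (hV : DifferentiableAt ℝ V u) :
    covWirtinger F c (fun t => h t • V t) u =
      wirtingerDeriv c h u • V u + h u • covWirtinger F c V u := by
  simp only [covWirtinger, wirtingerDeriv_smul hh hV, ← connectionCLM_apply, map_smul, smul_add,
    add_assoc]

theorem wirtingerDeriv_complexVelocity_sub (hF : ContDiffAt ℝ 2 (fun t => (F t).coords) u) :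
    wirtingerDeriv c (complexVelocity F d) u - wirtingerDeriv d (complexVelocity F c) u =
      connection (complexVelocity F d u) (complexVelocity F c u)
        - connection (complexVelocity F c u) (complexVelocity F d u) := by
  set φ : ℂ → Fin 3 → ℂ := fun t => complexify (F t).coords
  have hφ : ContDiffAt ℝ 2 φ u := complexify.contDiff.contDiffAt.comp u hF
  have hφd := hφ.differentiableAt two_ne_zero
  have hvelocity : ∀ᶠ t in nhds u, ∀ c, complexVelocity F c t =
      wirtingerDeriv c φ t + leftTransCLM (φ t) (wirtingerDeriv c φ t) :=
    (hF.eventually (by simp)).mono fun t ht _ =>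
      complexVelocity_eq_wirtingerDeriv (ht.differentiableAt two_ne_zero)
  have hderiv (c d : ℂ) : wirtingerDeriv c (complexVelocity F d) u =
      wirtingerDeriv c (wirtingerDeriv d φ) u
        + (leftTransCLM (wirtingerDeriv c φ u) (wirtingerDeriv d φ u)
          + leftTransCLM (φ u) (wirtingerDeriv c (wirtingerDeriv d φ) u)) := by
    have hdφ : DifferentiableAt ℝ (wirtingerDeriv d φ) u :=
      (contDiffAt_wirtingerDeriv hφ (m := 1) (by norm_num)).differentiableAt one_ne_zero
    rw [wirtingerDeriv_congr (hvelocity.mono fun t ht => ht d),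
      wirtingerDeriv_add hdφ (differentiableAt_bilin leftTransCLM hφd hdφ),
      wirtingerDeriv_bilin leftTransCLM hφd hdφ]
  rw [hderiv, hderiv, wirtingerDeriv_comm hφ, connection_sub_connection_swap,
    hvelocity.self_of_nhds c, hvelocity.self_of_nhds d]
  ext k
  fin_cases k <;> simp [leftTransCLM_apply, Matrix.vecHead, Matrix.vecTail]

theorem covWirtinger_complexVelocity_comm (hF : ContDiffAt ℝ 2 (fun t => (F t).coords) u) :
    covWirtinger F c (complexVelocity F d) u = covWirtinger F d (complexVelocity F c) u := by
  rw [covWirtinger, covWirtinger, ← sub_eq_zero, add_sub_add_comm,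
    wirtingerDeriv_complexVelocity_sub hF, sub_add_sub_cancel, sub_self]

theorem differentiableAt_covWirtinger (hF : ContDiffAt ℝ 2 (fun t => (F t).coords) u)
    (hV : ContDiffAt ℝ 2 V u) : DifferentiableAt ℝ (covWirtinger F c V) u :=
  ((contDiffAt_wirtingerDeriv hV (m := 1) (by norm_num)).differentiableAt one_ne_zero).add
    (differentiableAt_bilin connectionCLM (differentiableAt_complexVelocity hF)
      (hV.differentiableAt two_ne_zero))

theorem covWirtinger_covWirtinger_sub (hF : ContDiffAt ℝ 2 (fun t => (F t).coords) u)
    (hV : ContDiffAt ℝ 2 V u) :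
    covWirtinger F c (covWirtinger F d V) u - covWirtinger F d (covWirtinger F c V) u =
      curvature (complexVelocity F c u) (complexVelocity F d u) (V u) := by
  have expand (c d : ℂ) : covWirtinger F c (covWirtinger F d V) u =
      wirtingerDeriv c (wirtingerDeriv d V) u
        + connection (wirtingerDeriv c (complexVelocity F d) u) (V u)
        + connection (complexVelocity F d u) (wirtingerDeriv c V u)
        + connection (complexVelocity F c u) (wirtingerDeriv d V u)
        + connection (complexVelocity F c u) (connection (complexVelocity F d u) (V u)) := by
    have hVd := hV.differentiableAt two_ne_zero
    have hWd := differentiableAt_complexVelocity (c := d) hF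
    have hDV : DifferentiableAt ℝ (wirtingerDeriv d V) u :=
      (contDiffAt_wirtingerDeriv hV (m := 1) (by norm_num)).differentiableAt one_ne_zero
    have hsum := wirtingerDeriv_add (c := c) hDV (differentiableAt_bilin connectionCLM hWd hVd)
    rw [wirtingerDeriv_bilin connectionCLM hWd hVd] at hsum
    rw [covWirtinger, show wirtingerDeriv c (covWirtinger F d V) u = _ from hsum, covWirtinger]
    simp only [← connectionCLM_apply, map_add]
    abel
  have htorsion := congrArg (connectionCLM · (V u))
    (wirtingerDeriv_complexVelocity_sub hF (c := c) (d := d))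
  rw [expand c d, expand d c, wirtingerDeriv_comm hV, curvature]
  simp only [← connectionCLM_apply, map_sub, sub_apply] at htorsion ⊢
  linear_combination htorsion

theorem hopfCoeff_eq_covWirtinger_dotProduct (N : ℂ → Fin 3 → ℝ)
    (hF : ContDiffAt ℝ 2 (fun t => (F t).coords) u) :
    hopfCoeff F N u = covWirtinger F (-I) (zComp F) u ⬝ᵥ complexify (N u) := by
  have hZ : DifferentiableAt ℝ (zComp F) u :=
    zComp_eq_complexVelocity F ▸ differentiableAt_complexVelocity hF
  have hcomp (k : Fin 3) :
      wirtinger (fun t => zComp F t k) u = wirtingerDeriv (-I) (zComp F) u k := by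
    rw [wirtinger_eq_wirtingerDeriv]
    exact wirtingerDeriv_clm_apply (.proj k) hZ
  simp only [hopfCoeff, covWirtinger, hcomp, ← zComp_eq_complexVelocity]
  rfl

theorem covWirtinger_complexVelocity_eq (hF : ContDiffAt ℝ 2 (fun t => (F t).coords) u) :
    covWirtinger F I (complexVelocity F (-I)) u =
      (1 / 4 : ℂ) • complexify (covDeriv F u 1 1 + covDeriv F u I I) := by
  have hV (v : ℂ) : DifferentiableAt ℝ (fun t => leftVelocity F t v) u :=
    (contDiffAt_leftVelocity hF (m := 1) (by norm_num) v).differentiableAt one_ne_zero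
  have hcV (v : ℂ) : DifferentiableAt ℝ (fun t => complexify (leftVelocity F t v)) u :=
    complexify.differentiableAt.comp u (hV v)
  have hexpand (c d : ℂ) : covWirtinger F c (complexVelocity F d) u =
      (1 / 4 : ℂ) • (complexify (covDeriv F u 1 1) + d • complexify (covDeriv F u 1 I)
        + c • complexify (covDeriv F u I 1) + (c * d) • complexify (covDeriv F u I I)) := by
    have hderiv : wirtingerDeriv c (complexVelocity F d) u = (1 / 2 : ℂ) •
        (wirtingerDeriv c (fun t => complexify (leftVelocity F t 1)) u
          + d • wirtingerDeriv c (fun t => complexify (leftVelocity F t I)) u) := by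
      rw [← wirtingerDeriv_const_smul d (hcV I),
        ← wirtingerDeriv_add (hcV 1) ((hcV I).fun_const_smul d)]
      exact wirtingerDeriv_const_smul (1 / 2) ((hcV 1).add ((hcV I).fun_const_smul d))
    simp only [covWirtinger, hderiv, wirtingerDeriv_complexify (hV _), complexVelocity, covDeriv,
      map_add, ← connection_complexify, ← connectionCLM_apply, map_smul, add_apply,
      smul_apply]
    module
  have hsymm := covWirtinger_complexVelocity_comm hF (c := I) (d := -I)
  rw [hexpand, hexpand] at hsymm
  rw [hexpand, map_add]
  simp only [I_mul_I, mul_neg, neg_mul] at hsymm ⊢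
  linear_combination (norm := module) (1 / 2 : ℂ) • hsymm

end Covariant

/-! ### Conformal frames -/

section ConformalFrame

theorem cross_eq_dotProduct_self_smul_of_oriented {X Y n : Fin 3 → ℝ} (hXX : Y ⬝ᵥ Y = X ⬝ᵥ X)
    (hXY : X ⬝ᵥ Y = 0) (hnX : n ⬝ᵥ X = 0) (hnY : n ⬝ᵥ Y = 0) (hnn : n ⬝ᵥ n = 1)
    (hpos : 0 < n ⬝ᵥ X ⨯₃ Y) : X ⨯₃ Y = (X ⬝ᵥ X) • n := by
  have hparallel : X ⨯₃ Y = (n ⬝ᵥ X ⨯₃ Y) • n := by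
    have hnC : n ⨯₃ (X ⨯₃ Y) = 0 := by
      simp [cross_cross_eq_smul_sub_smul', hnY, dotProduct_comm X n, hnX]
    have hn := cross_cross_eq_smul_sub_smul' n n (X ⨯₃ Y)
    rwa [hnC, map_zero, hnn, one_smul, eq_comm, sub_eq_zero, eq_comm] at hn
  have hsq : (n ⬝ᵥ X ⨯₃ Y) ^ 2 = (X ⬝ᵥ X) ^ 2 := by
    have hlagrange := cross_dot_cross X Y X Y
    rw [hXX, hXY, hparallel, smul_dotProduct, dotProduct_smul, hnn] at hlagrange
    simpa [pow_two] using hlagrange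
  have hXnonneg : 0 ≤ X ⬝ᵥ X := Finset.sum_nonneg fun k _ => mul_self_nonneg (X k)
  rwa [(pow_left_inj₀ hpos.le hXnonneg two_ne_zero).1 hsq] at hparallel

/-- `Z` and `W` behave like `∂F` and `∂̄F`, and `N` like the unit normal, of a conformal immersion
`F` with metric `E |du|²`, in the complexified Euclidean space. -/
structure IsConformalFrame (Z W N : Fin 3 → ℂ) (E : ℂ) : Prop where
  factor_ne_zero : E ≠ 0
  left_self : Z ⬝ᵥ Z = 0
  right_self : W ⬝ᵥ W = 0
  left_right : Z ⬝ᵥ W = E / 2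
  normal_left : N ⬝ᵥ Z = 0
  normal_right : N ⬝ᵥ W = 0
  normal_self : N ⬝ᵥ N = 1
  cross : Z ⨯₃ W = (E / 2 * I) • N

namespace IsConformalFrame

theorem of_oriented {X Y n : Fin 3 → ℝ} (hXX : Y ⬝ᵥ Y = X ⬝ᵥ X) (hXY : X ⬝ᵥ Y = 0)
    (hnX : n ⬝ᵥ X = 0) (hnY : n ⬝ᵥ Y = 0) (hnn : n ⬝ᵥ n = 1) (hpos : 0 < n ⬝ᵥ X ⨯₃ Y) :
    IsConformalFrame ((1 / 2 : ℂ) • (complexify X + (-I) • complexify Y))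
      ((1 / 2 : ℂ) • (complexify X + I • complexify Y)) (complexify n) ((X ⬝ᵥ X : ℝ) : ℂ) := by
  have hcross := cross_eq_dotProduct_self_smul_of_oriented hXX hXY hnX hnY hnn hpos
  have hne : X ⬝ᵥ X ≠ 0 := fun h0 => by simp [hcross, h0] at hpos
  have hYX : Y ⬝ᵥ X = 0 := dotProduct_comm X Y ▸ hXY
  have hdot (a b : ℂ) : ((1 / 2 : ℂ) • (complexify X + a • complexify Y)) ⬝ᵥ
      ((1 / 2 : ℂ) • (complexify X + b • complexify Y)) = (1 + a * b) / 4 * (X ⬝ᵥ X : ℝ) := by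
    simp only [smul_dotProduct, dotProduct_smul, add_dotProduct, dotProduct_add,
      complexify_dotProduct, hXX, hXY, hYX, ofReal_zero, smul_eq_mul]
    ring
  have hnormal (a : ℂ) :
      complexify n ⬝ᵥ ((1 / 2 : ℂ) • (complexify X + a • complexify Y)) = 0 := by
    simp [complexify_dotProduct, hnX, hnY]
  refine ⟨mod_cast hne, ?_, ?_, ?_, hnormal _, hnormal _, ?_, ?_⟩
  · rw [hdot]
    simp
  · rw [hdot]
    simp
  · rw [hdot, neg_mul, I_mul_I]
    ring
  · simp [complexify_dotProduct, hnn]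
  · have hcross' : Y ⨯₃ X = -((X ⬝ᵥ X) • n) := by rw [← hcross, cross_anticomm]
    simp only [map_smul, map_add, LinearMap.smul_apply, LinearMap.add_apply,
      crossProduct_complexify, cross_self, hcross, hcross', map_neg, ← coe_smul]
    module

variable {Z W N : Fin 3 → ℂ} {E : ℂ} (h : IsConformalFrame Z W N E)
include h

theorem left_cross_normal : Z ⨯₃ N = (-I) • Z := by
  have hZ := cross_cross_eq_smul_sub_smul' Z Z W
  rw [h.cross, map_smul, h.left_self, h.left_right, zero_smul, sub_zero] at hZ
  have hEI : E / 2 * I ≠ 0 := by simp [h.factor_ne_zero]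
  refine smul_right_injective _ hEI ?_
  dsimp only
  rw [hZ, smul_smul]
  congr 1
  linear_combination E / 2 * I_mul_I

theorem eq_zero_of_dotProduct_eq_zero {D : Fin 3 → ℂ} (hZ : D ⬝ᵥ Z = 0) (hW : D ⬝ᵥ W = 0)
    (hN : D ⬝ᵥ N = 0) : D = 0 := by
  have hdet : Matrix.det ![N, Z, W] ≠ 0 := by
    rw [← triple_product_eq_det, h.cross, dotProduct_smul, h.normal_self]
    simpa using h.factor_ne_zero
  refine Matrix.eq_zero_of_mulVec_eq_zero hdet ?_
  ext k
  fin_cases k <;> simp [Matrix.mulVec, dotProduct_comm _ D, *]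

theorem eq_sum_dotProduct_smul (D : Fin 3 → ℂ) :
    D = (2 / E * (D ⬝ᵥ W)) • Z + (2 / E * (D ⬝ᵥ Z)) • W + (D ⬝ᵥ N) • N := by
  have hE := h.factor_ne_zero
  have hWZ : W ⬝ᵥ Z = E / 2 := dotProduct_comm W Z ▸ h.left_right
  have hZN : Z ⬝ᵥ N = 0 := dotProduct_comm Z N ▸ h.normal_left
  have hWN : W ⬝ᵥ N = 0 := dotProduct_comm W N ▸ h.normal_right
  rw [← sub_eq_zero]
  refine h.eq_zero_of_dotProduct_eq_zero ?_ ?_ ?_ <;>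
    simp only [sub_dotProduct, add_dotProduct, smul_dotProduct, h.left_self, h.right_self,
      h.left_right, h.normal_left, h.normal_right, h.normal_self, hWZ, hZN, hWN, smul_eq_mul] <;>
    field_simp <;> ring

theorem curvature_dotProduct_normal :
    NilGroup.curvature W Z Z ⬝ᵥ N = -(E / 2) * (N 2 * Z 2) := by
  rw [NilGroup.curvature_dotProduct, h.left_cross_normal, ← cross_anticomm, h.cross]
  simp only [neg_dotProduct, smul_dotProduct, dotProduct_smul, h.normal_left, Pi.neg_apply,
    Pi.smul_apply, smul_eq_mul]
  linear_combination (E / 2 * N 2 * Z 2) * I_mul_I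

theorem mul_eq_zero_of_isConformalFrame {p p' q q' E' : ℂ}
    (h' : IsConformalFrame (p • Z + q' • W) (q • Z + p' • W) N E') : q' * q = 0 := by
  have hdot : E' = (p * p' + q' * q) * E := by
    have h2 := h'.left_right
    simp only [add_dotProduct, dotProduct_add, smul_dotProduct, dotProduct_smul, h.left_self,
      h.right_self, dotProduct_comm W Z, h.left_right, smul_eq_mul] at h2
    linear_combination -2 * h2
  have hcross : E' = (p * p' - q' * q) * E := by
    have hWZ : W ⨯₃ Z = -((E / 2 * I) • N) := by rw [← h.cross, cross_anticomm]
    have h2 := congrArg (N ⬝ᵥ ·) h'.cross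
    simp only [map_add, map_smul, LinearMap.add_apply, LinearMap.smul_apply, cross_self, h.cross,
      hWZ, dotProduct_add, dotProduct_smul, dotProduct_neg, dotProduct_zero, h.normal_self,
      smul_eq_mul] at h2
    linear_combination (2 * I) * h2 + (E' - (p * p' - q' * q) * E) * I_mul_I
  have hqE : q' * q * E = 0 := by linear_combination 1 / 2 * (hcross - hdot)
  exact (mul_eq_zero.1 hqE).resolve_right h.factor_ne_zero

end IsConformalFrame

end ConformalFrame

/-! ### Conformal immersions of constant mean curvature -/

section ConformalImmersion

variable {F : ℂ → NilGroup} {N : ℂ → Fin 3 → ℝ} {U : Set ℂ} {V W : ℂ → Fin 3 → ℂ} {H : ℝ}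
  {c u : ℂ}

/-- `F` is a conformal immersion of the open set `U` into Nil, and `N` is its left translated unit
normal field compatible with the orientations. Third derivatives enter when covariant derivatives of
`∂F` are exchanged. -/
structure IsConformalImmersion (F : ℂ → NilGroup) (N : ℂ → Fin 3 → ℝ) (U : Set ℂ) : Prop where
  isOpen : IsOpen U
  contDiffOn : ContDiffOn ℝ 3 (fun t => (F t).coords) U
  conformal : ∀ u ∈ U, ∃ r : ℝ, firstFundamentalForm F u = r • 1
  normal_self : ∀ u ∈ U, N u ⬝ᵥ N u = 1
  normal_leftVelocity : ∀ u ∈ U, ∀ a, N u ⬝ᵥ leftVelocity F u a = 0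
  oriented : ∀ u ∈ U, 0 < N u ⬝ᵥ leftVelocity F u 1 ⨯₃ leftVelocity F u I

/-- The function `E` in the metric `E |du|²` of a conformal immersion, as a complex number. -/
noncomputable def conformalFactor (F : ℂ → NilGroup) (u : ℂ) : ℂ :=
  2 * (zComp F u ⬝ᵥ complexVelocity F I u)

theorem IsConformalImmersion.mono {U' : Set ℂ} (hF : IsConformalImmersion F N U')
    (hU : IsOpen U) (hUU' : U ⊆ U') : IsConformalImmersion F N U where
  isOpen := hU
  contDiffOn := hF.contDiffOn.mono hUU'
  conformal u hu := hF.conformal u (hUU' hu)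
  normal_self u hu := hF.normal_self u (hUU' hu)
  normal_leftVelocity u hu := hF.normal_leftVelocity u (hUU' hu)
  oriented u hu := hF.oriented u (hUU' hu)

theorem covWirtinger_congr (F : ℂ → NilGroup) (hVW : V =ᶠ[nhds u] W) :
    covWirtinger F c V u = covWirtinger F c W u := by
  rw [covWirtinger, covWirtinger, wirtingerDeriv_congr hVW, hVW.eq_of_nhds]

theorem leftVelocity_dotProduct_of_firstFundamentalForm_eq_smul_one {r : ℝ}
    (hr : firstFundamentalForm F u = r • 1) :
    leftVelocity F u 1 ⬝ᵥ leftVelocity F u 1 = r ∧ leftVelocity F u I ⬝ᵥ leftVelocity F u I = r ∧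
      leftVelocity F u 1 ⬝ᵥ leftVelocity F u I = 0 := by
  have hentry (i j : Fin 2) := congrFun (congrFun hr i) j
  simp only [firstFundamentalForm, coordDir, Matrix.of_apply] at hentry
  exact ⟨by simpa using hentry 0 0, by simpa using hentry 1 1, by simpa using hentry 0 1⟩

theorem covDeriv_add_covDeriv_dotProduct_of_firstFundamentalForm_eq_smul_one {r : ℝ} (hr₀ : r ≠ 0)
    (hr : firstFundamentalForm F u = r • 1) :
    (covDeriv F u 1 1 + covDeriv F u I I) ⬝ᵥ N u = 2 * r * meanCurvature F N u := by
  have hinv : (r • (1 : Matrix (Fin 2) (Fin 2) ℝ))⁻¹ = r⁻¹ • 1 :=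
    Matrix.inv_eq_left_inv (by simp [smul_smul, hr₀])
  rw [meanCurvature, hr, hinv, smul_one_mul, Matrix.trace_smul, Matrix.trace_fin_two]
  simp only [secondFundamentalForm, coordDir, Matrix.of_apply, Matrix.cons_val, add_dotProduct,
    smul_eq_mul]
  field_simp

namespace IsConformalImmersion

variable (hF : IsConformalImmersion F N U) (hu : u ∈ U)
include hF hu

theorem contDiffAt : ContDiffAt ℝ 3 (fun t => (F t).coords) u :=
  hF.contDiffOn.contDiffAt (hF.isOpen.mem_nhds hu)

theorem contDiffAt_two : ContDiffAt ℝ 2 (fun t => (F t).coords) u :=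
  (hF.contDiffAt hu).of_le (by norm_num)

theorem contDiffAt_zComp : ContDiffAt ℝ 2 (zComp F) u :=
  zComp_eq_complexVelocity F ▸ contDiffAt_complexVelocity (hF.contDiffAt hu) (by norm_num)

theorem differentiableAt_zComp : DifferentiableAt ℝ (zComp F) u :=
  (hF.contDiffAt_zComp hu).differentiableAt two_ne_zero

theorem isConformalFrame_of_firstFundamentalForm_eq {r : ℝ}
    (hr : firstFundamentalForm F u = r • 1) :
    IsConformalFrame (zComp F u) (complexVelocity F I u) (complexify (N u)) r := by
  obtain ⟨h11, hII, h1I⟩ := leftVelocity_dotProduct_of_firstFundamentalForm_eq_smul_one hr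
  rw [zComp_eq_complexVelocity, ← h11]
  exact .of_oriented (hII.trans h11.symm) h1I (hF.normal_leftVelocity u hu 1)
    (hF.normal_leftVelocity u hu I) (hF.normal_self u hu) (hF.oriented u hu)

theorem conformalFactor_eq_of_firstFundamentalForm_eq {r : ℝ}
    (hr : firstFundamentalForm F u = r • 1) : conformalFactor F u = r := by
  rw [conformalFactor, (hF.isConformalFrame_of_firstFundamentalForm_eq hu hr).left_right,
    mul_div_cancel₀ _ two_ne_zero]

theorem isConformalFrame : IsConformalFrame (zComp F u) (complexVelocity F I u)
    (complexify (N u)) (conformalFactor F u) := by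
  obtain ⟨r, hr⟩ := hF.conformal u hu
  rw [hF.conformalFactor_eq_of_firstFundamentalForm_eq hu hr]
  exact hF.isConformalFrame_of_firstFundamentalForm_eq hu hr

theorem differentiableAt_conformalFactor : DifferentiableAt ℝ (conformalFactor F) u :=
  (differentiableAt_bilin dotProductCLM (hF.differentiableAt_zComp hu)
    (differentiableAt_complexVelocity (hF.contDiffAt_two hu))).const_mul 2

theorem eventually_mem : ∀ᶠ t in nhds u, t ∈ U := hF.isOpen.mem_nhds hu

theorem differentiableAt_normal : DifferentiableAt ℝ (fun t => complexify (N t)) u := by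
  have hcross : DifferentiableAt ℝ (fun t => zComp F t ⨯₃ complexVelocity F I t) u := by
    let B : (Fin 3 → ℂ) →L[ℂ] (Fin 3 → ℂ) →L[ℂ] (Fin 3 → ℂ) :=
      crossProduct.toContinuousBilinearMap
    exact differentiableAt_bilin B (hF.differentiableAt_zComp hu)
      (differentiableAt_complexVelocity (hF.contDiffAt_two hu))
  have hE : conformalFactor F u ≠ 0 := (hF.isConformalFrame hu).factor_ne_zero
  have hinv : DifferentiableAt ℝ (fun t => (conformalFactor F t)⁻¹ * (-2 * I)) u :=
    ((hF.differentiableAt_conformalFactor hu).fun_inv hE).mul_const _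
  refine (hinv.fun_smul hcross).congr_of_eventuallyEq ?_
  filter_upwards [hF.eventually_mem hu] with t ht
  have hframe := hF.isConformalFrame ht
  have hunit : (conformalFactor F t)⁻¹ * (-2 * I) * (conformalFactor F t / 2 * I) = 1 := by
    linear_combination -I_mul_I - I * I * inv_mul_cancel₀ hframe.factor_ne_zero
  rw [hframe.cross, smul_smul, hunit, one_smul]

theorem covWirtinger_dotProduct_eq_zero_of_dotProduct_self_eqOn_const {a : ℂ}
    (hV : DifferentiableAt ℝ V u) (ha : ∀ t ∈ U, V t ⬝ᵥ V t = a) (c : ℂ) :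
    covWirtinger F c V u ⬝ᵥ V u = 0 := by
  have hVV := wirtingerDeriv_dotProduct (c := c) F hV hV
  rw [wirtingerDeriv_eq_zero_of_eqOn_const hF.isOpen hu ha, dotProduct_comm (V u)] at hVV
  linear_combination (-1 / 2 : ℂ) * hVV

theorem covWirtinger_zComp_dotProduct_zComp (c : ℂ) :
    covWirtinger F c (zComp F) u ⬝ᵥ zComp F u = 0 :=
  hF.covWirtinger_dotProduct_eq_zero_of_dotProduct_self_eqOn_const hu
    (hF.differentiableAt_zComp hu) (fun _ ht => (hF.isConformalFrame ht).left_self) c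

theorem covWirtinger_normal_dotProduct_normal (c : ℂ) :
    covWirtinger F c (fun t => complexify (N t)) u ⬝ᵥ complexify (N u) = 0 :=
  hF.covWirtinger_dotProduct_eq_zero_of_dotProduct_self_eqOn_const hu
    (hF.differentiableAt_normal hu) (fun _ ht => (hF.isConformalFrame ht).normal_self) c

theorem covWirtinger_complexVelocity_I_eq_covWirtinger_zComp :
    covWirtinger F (-I) (complexVelocity F I) u = covWirtinger F I (zComp F) u :=
  zComp_eq_complexVelocity F ▸ covWirtinger_complexVelocity_comm (hF.contDiffAt_two hu)

theorem covWirtinger_zComp_dotProduct_normal :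
    covWirtinger F I (zComp F) u ⬝ᵥ complexify (N u) =
      conformalFactor F u * meanCurvature F N u / 2 := by
  obtain ⟨r, hr⟩ := hF.conformal u hu
  have hr₀ : r ≠ 0 := mod_cast
    (hF.isConformalFrame_of_firstFundamentalForm_eq hu hr).factor_ne_zero
  rw [zComp_eq_complexVelocity, covWirtinger_complexVelocity_eq (hF.contDiffAt_two hu),
    smul_dotProduct, complexify_dotProduct,
    covDeriv_add_covDeriv_dotProduct_of_firstFundamentalForm_eq_smul_one hr₀ hr,
    hF.conformalFactor_eq_of_firstFundamentalForm_eq hu hr, smul_eq_mul]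
  push_cast
  ring

theorem covWirtinger_zComp_eq_smul_normal : covWirtinger F I (zComp F) u =
    (conformalFactor F u * meanCurvature F N u / 2) • complexify (N u) := by
  have hW : covWirtinger F I (zComp F) u ⬝ᵥ complexVelocity F I u = 0 := by
    rw [← hF.covWirtinger_complexVelocity_I_eq_covWirtinger_zComp hu]
    exact hF.covWirtinger_dotProduct_eq_zero_of_dotProduct_self_eqOn_const hu
      (differentiableAt_complexVelocity (hF.contDiffAt_two hu))
      (fun _ ht => (hF.isConformalFrame ht).right_self) (-I)
  rw [(hF.isConformalFrame hu).eq_sum_dotProduct_smul (covWirtinger F I (zComp F) u), hW,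
    hF.covWirtinger_zComp_dotProduct_zComp hu, hF.covWirtinger_zComp_dotProduct_normal hu]
  simp only [mul_zero, zero_smul, zero_add]

theorem covWirtinger_normal_dotProduct_zComp :
    covWirtinger F I (fun t => complexify (N t)) u ⬝ᵥ zComp F u =
      -(conformalFactor F u * meanCurvature F N u / 2) := by
  have hNZ := wirtingerDeriv_dotProduct (c := I) F (hF.differentiableAt_normal hu)
    (hF.differentiableAt_zComp hu)
  rw [wirtingerDeriv_eq_zero_of_eqOn_const hF.isOpen hu
    fun t ht => (hF.isConformalFrame ht).normal_left, dotProduct_comm (complexify _),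
    hF.covWirtinger_zComp_dotProduct_normal hu] at hNZ
  linear_combination -hNZ

theorem exists_covWirtinger_normal_eq : ∃ a : ℂ, covWirtinger F I (fun t => complexify (N t)) u =
    a • zComp F u - (meanCurvature F N u : ℂ) • complexVelocity F I u := by
  have hE := (hF.isConformalFrame hu).factor_ne_zero
  refine ⟨2 / conformalFactor F u *
    (covWirtinger F I (fun t => complexify (N t)) u ⬝ᵥ complexVelocity F I u),
    ((hF.isConformalFrame hu).eq_sum_dotProduct_smul _).trans ?_⟩
  rw [hF.covWirtinger_normal_dotProduct_zComp hu, hF.covWirtinger_normal_dotProduct_normal hu,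
    zero_smul, add_zero, sub_eq_add_neg, ← neg_smul]
  congr 2
  field_simp

theorem wirtingerDeriv_conformalFactor :
    wirtingerDeriv (-I) (conformalFactor F) u =
      2 * (covWirtinger F (-I) (zComp F) u ⬝ᵥ complexVelocity F I u) := by
  have hZ := hF.differentiableAt_zComp hu
  have hW := differentiableAt_complexVelocity (c := I) (hF.contDiffAt_two hu)
  have hZN : zComp F u ⬝ᵥ complexify (N u) = 0 :=
    dotProduct_comm (zComp F u) _ ▸ (hF.isConformalFrame hu).normal_left
  have hZW := wirtingerDeriv_dotProduct (c := -I) F hZ hW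
  rw [hF.covWirtinger_complexVelocity_I_eq_covWirtinger_zComp hu,
    hF.covWirtinger_zComp_eq_smul_normal hu, dotProduct_smul, hZN, smul_zero, add_zero] at hZW
  rw [← hZW]
  exact wirtingerDeriv_const_smul 2 (differentiableAt_bilin dotProductCLM hZ hW)

theorem covWirtinger_covWirtinger_zComp_dotProduct_normal
    (hH : ∀ t ∈ U, meanCurvature F N t = H) :
    covWirtinger F (-I) (covWirtinger F I (zComp F)) u ⬝ᵥ complexify (N u) =
      H * (covWirtinger F (-I) (zComp F) u ⬝ᵥ complexVelocity F I u) := by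
  have hE := hF.differentiableAt_conformalFactor hu
  have heq : covWirtinger F I (zComp F) =ᶠ[nhds u]
      fun t => ((H / 2 : ℂ) • conformalFactor F t) • complexify (N t) := by
    filter_upwards [hF.eventually_mem hu] with t ht
    rw [hF.covWirtinger_zComp_eq_smul_normal ht, hH t ht, smul_eq_mul]
    ring_nf
  rw [covWirtinger_congr F heq, covWirtinger_smul F (hE.fun_const_smul _)
    (hF.differentiableAt_normal hu), add_dotProduct, smul_dotProduct, smul_dotProduct,
    hF.covWirtinger_normal_dotProduct_normal hu, (hF.isConformalFrame hu).normal_self,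
    wirtingerDeriv_const_smul _ hE, hF.wirtingerDeriv_conformalFactor hu]
  simp only [smul_eq_mul]
  ring

theorem hopfCoeff_eventuallyEq : hopfCoeff F N =ᶠ[nhds u]
    fun t => covWirtinger F (-I) (zComp F) t ⬝ᵥ complexify (N t) := by
  filter_upwards [hF.eventually_mem hu] with t ht
  exact hopfCoeff_eq_covWirtinger_dotProduct N (hF.contDiffAt_two ht)

theorem differentiableAt_hopfCoeff : DifferentiableAt ℝ (hopfCoeff F N) u :=
  (differentiableAt_bilin dotProductCLM
    (differentiableAt_covWirtinger (hF.contDiffAt_two hu) (hF.contDiffAt_zComp hu))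
    (hF.differentiableAt_normal hu)).congr_of_eventuallyEq (hF.hopfCoeff_eventuallyEq hu)

theorem wirtingerDeriv_hopfCoeff (hH : ∀ t ∈ U, meanCurvature F N t = H) :
    wirtingerDeriv I (hopfCoeff F N) u = -(conformalFactor F u / 2) * (N u 2 * zComp F u 2) := by
  obtain ⟨a, ha⟩ := hF.exists_covWirtinger_normal_eq hu
  have hcurv := congrArg (· ⬝ᵥ complexify (N u)) (covWirtinger_covWirtinger_sub (c := I) (d := -I)
    (hF.contDiffAt_two hu) (hF.contDiffAt_zComp hu))
  simp only [← zComp_eq_complexVelocity, sub_dotProduct,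
    hF.covWirtinger_covWirtinger_zComp_dotProduct_normal hu hH,
    (hF.isConformalFrame hu).curvature_dotProduct_normal, complexify_apply] at hcurv
  rw [wirtingerDeriv_congr (hF.hopfCoeff_eventuallyEq hu), wirtingerDeriv_dotProduct F
    (differentiableAt_covWirtinger (hF.contDiffAt_two hu) (hF.contDiffAt_zComp hu))
    (hF.differentiableAt_normal hu), ha, dotProduct_sub, dotProduct_smul, dotProduct_smul,
    hF.covWirtinger_zComp_dotProduct_zComp hu, hH u hu]
  simp only [smul_eq_mul]
  linear_combination hcurv

theorem wirtingerDeriv_zComp_two : wirtingerDeriv I (fun t => zComp F t 2) u =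
    conformalFactor F u / 4 * (2 * meanCurvature F N u + I) * N u 2 := by
  have hproj : wirtingerDeriv I (fun t => zComp F t 2) u = wirtingerDeriv I (zComp F) u 2 :=
    wirtingerDeriv_clm_apply (.proj 2) (hF.differentiableAt_zComp hu)
  have hZ := congrFun (hF.covWirtinger_zComp_eq_smul_normal hu) 2
  have hcross := congrFun (hF.isConformalFrame hu).cross 2
  simp only [covWirtinger, NilGroup.connection_eq, cross_apply, Pi.add_apply, Pi.smul_apply,
    complexify_apply, Matrix.cons_val, smul_eq_mul] at hZ hcross
  linear_combination hproj + hZ + 1 / 2 * hcross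

end IsConformalImmersion

theorem IsConformalImmersion.differentiableOn_abreschCoeff (hF : IsConformalImmersion F N U)
    (hH : ∀ t ∈ U, meanCurvature F N t = H) : DifferentiableOn ℂ (abreschCoeff F N H) U := by
  intro u hu
  have hden : 2 * (H : ℂ) + I ≠ 0 := fun h0 => by simpa using congrArg im h0
  have hA := hF.differentiableAt_hopfCoeff hu
  have hZ : DifferentiableAt ℝ (fun t => zComp F t 2) u :=
    differentiableAt_pi.1 (hF.differentiableAt_zComp hu) 2
  have hZZ : DifferentiableAt ℝ (fun t => zComp F t 2 • zComp F t 2) u := hZ.fun_smul hZ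
  have habresch : abreschCoeff F N H =
      fun t => hopfCoeff F N t + (2 * (H : ℂ) + I)⁻¹ • zComp F t 2 • zComp F t 2 := by
    funext t
    simp only [abreschCoeff, smul_eq_mul]
    ring
  rw [habresch]
  refine (differentiableAt_complex_iff_wirtingerDeriv.2
    ⟨hA.fun_add (hZZ.fun_const_smul _), ?_⟩).differentiableWithinAt
  rw [wirtingerDeriv_add hA (hZZ.fun_const_smul _), wirtingerDeriv_const_smul _ hZZ,
    wirtingerDeriv_smul hZ hZ, hF.wirtingerDeriv_hopfCoeff hu hH, hF.wirtingerDeriv_zComp_two hu,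
    hH u hu]
  simp only [smul_eq_mul]
  field_simp
  ring

end ConformalImmersion

/-! ### Changes of conformal parameter -/

section Reparametrization

variable {F F' G : ℂ → NilGroup} {N N' : ℂ → Fin 3 → ℝ} {V : ℂ → Fin 3 → ℂ} {g : ℂ → ℂ}
  {U U' : Set ℂ} {c u : ℂ}

theorem complexVelocity_congr (hFF' : F =ᶠ[nhds u] F') :
    complexVelocity F c u = complexVelocity F' c u := by
  have hcoords : (fun t => (F t).coords) =ᶠ[nhds u] fun t => (F' t).coords :=
    hFF'.fun_comp NilGroup.coords
  simp only [complexVelocity, leftVelocity, hcoords.fderiv_eq, hFF'.eq_of_nhds]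

theorem complexVelocity_comp (hG : DifferentiableAt ℝ (fun t => (G t).coords) (g u))
    (hg : DifferentiableAt ℝ g u) : complexVelocity (fun t => G (g t)) c u =
      wirtingerDeriv c g u • complexVelocity G (-I) (g u) +
        conj (wirtingerDeriv (conj c) g u) • complexVelocity G I (g u) := by
  have hGg : DifferentiableAt ℝ (fun t => (G (g t)).coords) u := hG.comp u hg
  have hcG : DifferentiableAt ℝ (fun t => complexify (G t).coords) (g u) :=
    complexify.differentiableAt.comp _ hG
  rw [complexVelocity_eq_wirtingerDeriv hGg, complexVelocity_eq_wirtingerDeriv hG,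
    complexVelocity_eq_wirtingerDeriv hG, wirtingerDeriv_comp hcG hg, map_add, map_smul, map_smul]
  module

theorem covWirtinger_comp (hG : DifferentiableAt ℝ (fun t => (G t).coords) (g u))
    (hV : DifferentiableAt ℝ V (g u)) (hg : DifferentiableAt ℂ g u) :
    covWirtinger (fun t => G (g t)) (-I) (fun t => V (g t)) u =
      deriv g u • covWirtinger G (-I) V (g u) := by
  obtain ⟨hgR, hgI⟩ := differentiableAt_complex_iff_wirtingerDeriv.1 hg
  have hconj : conj (wirtingerDeriv (conj (-I)) g u) = 0 := by
    rw [map_neg, conj_I, neg_neg, hgI, map_zero]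
  rw [covWirtinger, covWirtinger, wirtingerDeriv_comp hV hgR, complexVelocity_comp hG hgR, hconj,
    wirtingerDeriv_neg_I_eq_deriv hg, zero_smul, zero_smul, add_zero, add_zero, smul_add]
  simp only [← NilGroup.connectionCLM_apply, map_smul, smul_apply]

/-- The conformal immersion `F` of `U` with normal `N` is obtained from the conformal immersion `G`
of `U'` with normal `N'` by the change of parameter `g`. -/
structure IsReparametrization (F G : ℂ → NilGroup) (N N' : ℂ → Fin 3 → ℝ) (g : ℂ → ℂ)
    (U U' : Set ℂ) : Prop where
  left : IsConformalImmersion F N U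
  right : IsConformalImmersion G N' U'
  differentiableAt_real : ∀ u ∈ U, DifferentiableAt ℝ g u
  mapsTo : Set.MapsTo g U U'
  map_eq : ∀ u ∈ U, F u = G (g u)
  normal_eq : ∀ u ∈ U, N u = N' (g u)

namespace IsReparametrization

variable (hFG : IsReparametrization F G N N' g U U') (hu : u ∈ U)
include hFG hu

theorem map_eventuallyEq : F =ᶠ[nhds u] fun t => G (g t) :=
  Filter.eventually_of_mem (hFG.left.isOpen.mem_nhds hu) hFG.map_eq

theorem differentiableAt_coords : DifferentiableAt ℝ (fun t => (G t).coords) (g u) :=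
  (hFG.right.contDiffAt (hFG.mapsTo hu)).differentiableAt (by norm_num)

theorem complexVelocity_eq (c : ℂ) : complexVelocity F c u =
    wirtingerDeriv c g u • complexVelocity G (-I) (g u) +
      conj (wirtingerDeriv (conj c) g u) • complexVelocity G I (g u) := by
  rw [complexVelocity_congr (hFG.map_eventuallyEq hu),
    complexVelocity_comp (hFG.differentiableAt_coords hu) (hFG.differentiableAt_real u hu)]

theorem differentiableAt : DifferentiableAt ℂ g u := by
  refine differentiableAt_complex_iff_wirtingerDeriv.2 ⟨hFG.differentiableAt_real u hu, ?_⟩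
  have hF := hFG.left.isConformalFrame hu
  have hG := hFG.right.isConformalFrame (hFG.mapsTo hu)
  rw [zComp_eq_complexVelocity, hFG.complexVelocity_eq hu, hFG.complexVelocity_eq hu,
    hFG.normal_eq u hu] at hF
  rw [zComp_eq_complexVelocity] at hG
  simpa using hG.mul_eq_zero_of_isConformalFrame hF

theorem zComp_eq : zComp F u = deriv g u • zComp G (g u) := by
  have hg := hFG.differentiableAt hu
  obtain ⟨-, hgI⟩ := differentiableAt_complex_iff_wirtingerDeriv.1 hg
  rw [zComp_eq_complexVelocity, zComp_eq_complexVelocity, hFG.complexVelocity_eq hu,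
    wirtingerDeriv_neg_I_eq_deriv hg, map_neg, conj_I, neg_neg, hgI, map_zero, zero_smul, add_zero]

theorem differentiableAt_deriv : DifferentiableAt ℂ (deriv g) u :=
  have hg : DifferentiableOn ℂ g U := fun _ ht => (hFG.differentiableAt ht).differentiableWithinAt
  (hg.deriv hFG.left.isOpen).differentiableAt (hFG.left.isOpen.mem_nhds hu)

theorem hopfCoeff_eq : hopfCoeff F N u = hopfCoeff G N' (g u) * deriv g u ^ 2 := by
  have hgu := hFG.mapsTo hu
  have hg := hFG.differentiableAt hu
  have hZ := hFG.right.differentiableAt_zComp hgu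
  have hZF : zComp F =ᶠ[nhds u] fun t => deriv g t • zComp G (g t) :=
    Filter.eventually_of_mem (hFG.left.isOpen.mem_nhds hu) fun _ ht => hFG.zComp_eq ht
  have hZg : DifferentiableAt ℝ (fun t => zComp G (g t)) u := hZ.comp u (hg.restrictScalars ℝ)
  have hZN : zComp G (g u) ⬝ᵥ complexify (N' (g u)) = 0 :=
    dotProduct_comm (zComp G (g u)) _ ▸ (hFG.right.isConformalFrame hgu).normal_left
  have hcov : covWirtinger F (-I) (fun t => zComp G (g t)) u =
      deriv g u • covWirtinger G (-I) (zComp G) (g u) := by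
    rw [← covWirtinger_comp (hFG.differentiableAt_coords hu) hZ hg, covWirtinger, covWirtinger,
      complexVelocity_congr (hFG.map_eventuallyEq hu)]
  rw [hopfCoeff_eq_covWirtinger_dotProduct N (hFG.left.contDiffAt_two hu),
    hopfCoeff_eq_covWirtinger_dotProduct N' (hFG.right.contDiffAt_two hgu),
    covWirtinger_congr F hZF,
    covWirtinger_smul F ((hFG.differentiableAt_deriv hu).restrictScalars ℝ) hZg, hcov,
    hFG.normal_eq u hu]
  simp only [add_dotProduct, smul_dotProduct, hZN, smul_eq_mul]
  ring

theorem abreschCoeff_eq (H : ℝ) :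
    abreschCoeff F N H u = abreschCoeff G N' H (g u) * deriv g u ^ 2 := by
  rw [abreschCoeff, abreschCoeff, hFG.hopfCoeff_eq hu, hFG.zComp_eq hu, Pi.smul_apply, smul_eq_mul]
  ring

end IsReparametrization

end Reparametrization

/-! ### Conformal parameters of a surface -/

section ConformalParameter

variable {M : Type*} [TopologicalSpace M] [ChartedSpace ℂ M] {f : M → NilGroup}
  {n : M → Fin 3 → ℝ} {z w : OpenPartialHomeomorph M ℂ}

theorem IsNilImmersion.contDiffOn_comp_symm (hf : IsNilImmersion f)
    (hz : z ∈ IsManifold.maximalAtlas 𝓘(ℝ, ℂ) ∞ M) :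
    ContDiffOn ℝ ∞ (fun t => (f (z.symm t)).coords) z.target :=
  (hf.1.comp_contMDiffOn (contMDiffOn_symm_of_mem_maximalAtlas hz)).contDiffOn

theorem IsNilUnitNormal.dotProduct_leftVelocity_comp_symm (hn : IsNilUnitNormal f n)
    (hf : IsNilImmersion f) (hz : z ∈ IsManifold.maximalAtlas 𝓘(ℝ, ℂ) ∞ M) {u : ℂ}
    (hu : u ∈ z.target) (a : ℂ) :
    n (z.symm u) ⬝ᵥ leftVelocity (f ∘ z.symm) u a = 0 := by
  have hzu : MDifferentiableAt 𝓘(ℝ, ℂ) 𝓘(ℝ, ℂ) z.symm u :=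
    ((contMDiffOn_symm_of_mem_maximalAtlas hz).contMDiffAt
      (z.open_target.mem_nhds hu)).mdifferentiableAt (by simp)
  have hfu := (hf.1 (z.symm u)).mdifferentiableAt (by simp)
  have hchain := mfderiv_comp u hfu hzu
  rw [mfderiv_eq_fderiv] at hchain
  have ha : fderiv ℝ (fun t => (f (z.symm t)).coords) u a = mfderiv 𝓘(ℝ, ℂ) 𝓘(ℝ, Fin 3 → ℝ)
      (fun q => (f q).coords) (z.symm u) (mfderiv 𝓘(ℝ, ℂ) 𝓘(ℝ, ℂ) z.symm u a) :=
    DFunLike.congr_fun hchain a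
  simp only [leftVelocity, Function.comp_apply, ha]
  exact hn.2.2 (z.symm u) (mfderiv 𝓘(ℝ, ℂ) 𝓘(ℝ, ℂ) z.symm u a)

theorem IsConformalParameter.isConformalImmersion (hz : IsConformalParameter f n z)
    (hf : IsNilImmersion f) (hn : IsNilUnitNormal f n) :
    IsConformalImmersion (f ∘ z.symm) (n ∘ z.symm) z.target where
  isOpen := z.open_target
  contDiffOn := contDiffOn_infty.1 (hf.contDiffOn_comp_symm hz.1) 3
  conformal u hu := (hz.2 u hu).1.imp' (fun α => Real.exp (2 * α)) fun _ h => h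
  normal_self _ _ := hn.2.1 _
  normal_leftVelocity _ hu a := hn.dotProduct_leftVelocity_comp_symm hf hz.1 hu a
  oriented u hu := (hz.2 u hu).2

theorem IsConformalParameter.isReparametrization (hz : IsConformalParameter f n z)
    (hw : IsConformalParameter f n w) (hf : IsNilImmersion f) (hn : IsNilUnitNormal f n) :
    IsReparametrization (f ∘ z.symm) (f ∘ w.symm) (n ∘ z.symm) (n ∘ w.symm) (w ∘ z.symm)
      (z.symm.trans w).source w.target := by
  have hopen : IsOpen (z.symm.trans w).source := (z.symm.trans w).open_source
  have hsub : (z.symm.trans w).source ⊆ z.target := fun _ ht => ht.1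
  have hmem : ∀ t ∈ (z.symm.trans w).source, z.symm t ∈ w.source := fun _ ht => ht.2
  have hsmooth : ContDiffOn ℝ ∞ (w ∘ z.symm) (z.symm.trans w).source :=
    ((contMDiffOn_of_mem_maximalAtlas hw.1).comp
      ((contMDiffOn_symm_of_mem_maximalAtlas hz.1).mono hsub) hmem).contDiffOn
  exact {
    left := (hz.isConformalImmersion hf hn).mono hopen hsub
    right := hw.isConformalImmersion hf hn
    differentiableAt_real := fun u hu =>
      (hsmooth.contDiffAt (hopen.mem_nhds hu)).differentiableAt (by simp)
    mapsTo := fun t ht => w.map_source (hmem t ht)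
    map_eq := fun t ht => by simp [w.left_inv (hmem t ht)]
    normal_eq := fun t ht => by simp [w.left_inv (hmem t ht)] }

end ConformalParameter

end AbreschRosenberg

theorem mainTheorem4 {M : Type*} [TopologicalSpace M] [ChartedSpace ℂ M]
    [IsManifold 𝓘(ℝ, ℂ) ∞ M] (f : M → NilGroup) (n : M → Fin 3 → ℝ) (H : ℝ)
    (hf : IsNilImmersion f) (hn : IsNilUnitNormal f n) (hH : HasConstMeanCurvature f n H) :
    -- the coefficient of the differential is holomorphic in every conformal parameter
    (∀ z : OpenPartialHomeomorph M ℂ, IsConformalParameter f n z →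
      DifferentiableOn ℂ (abreschCoeff (f ∘ z.symm) (n ∘ z.symm) H) z.target ∧
      ∀ ψ₁ ψ₂ : ℂ → ℂ, IsGeneratingSpinor (f ∘ z.symm) z.target ψ₁ ψ₂ →
        DifferentiableOn ℂ
          (fun u => hopfCoeff (f ∘ z.symm) (n ∘ z.symm) u
            + (ψ₁ u * conj (ψ₂ u)) ^ 2 / (2 * (H : ℂ) + Complex.I)) z.target) ∧
    -- changes of conformal parameter are holomorphic, and the coefficients transform as those of a
    -- quadratic differential
    (∀ z w : OpenPartialHomeomorph M ℂ,
      IsConformalParameter f n z → IsConformalParameter f n w →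
      DifferentiableOn ℂ (w ∘ z.symm) (z.symm.trans w).source ∧
      ∀ u ∈ (z.symm.trans w).source,
        abreschCoeff (f ∘ z.symm) (n ∘ z.symm) H u =
          abreschCoeff (f ∘ w.symm) (n ∘ w.symm) H (w (z.symm u))
            * deriv (w ∘ z.symm) u ^ 2) := by
  refine ⟨fun z hz => ?_, fun z w hz hw => ?_⟩
  · have habresch : DifferentiableOn ℂ (abreschCoeff (f ∘ z.symm) (n ∘ z.symm) H) z.target :=
      (hz.isConformalImmersion hf hn).differentiableOn_abreschCoeff (hH z hz.1)
    refine ⟨habresch, fun ψ₁ ψ₂ hψ => habresch.congr fun u hu => ?_⟩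
    rw [abreschCoeff, (hψ u hu).2.2]
  · have hreparam := hz.isReparametrization hw hf hn
    exact ⟨fun u hu => (hreparam.differentiableAt hu).differentiableWithinAt,
      fun u hu => hreparam.abreschCoeff_eq hu H⟩
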